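/- Let $k$ be an algebraically closed field of characteristic $0$. Let $L_1, L_2, L_3$ be three mutually disjoint lines in $\mathbb{P}^3 = \mathbb{P}^3_k$, let $Y := L_1 \cup L_2 \cup L_3$, and let $P_0, P_1, P_2, P_3$ be four points of $\mathbb{P}^3$ such that $W := \{P_0, P_1, P_2, P_3\}$ is not contained in a plane. Assume that none of the four points belongs to the (unique) quadric surface $Q \subset \mathbb{P}^3$ containing $Y$, and that, for $l = 1, 2, 3$, $H^0(\mathscr{I}_{(Y \setminus L_l) \cup W}(2)) = 0$, that is, no nonzero quadratic form in $k[x_0, x_1, x_2, x_3]$ vanishes on $W$ and on the two lines among $L_1, L_2, L_3$ different from $L_l$. Then the homogeneous ideal of $Y \cup W$, that is, the ideal of $k[x_0, x_1, x_2, x_3]$ generated by all the homogeneous polynomials vanishing on $Y \cup W$, is generated by cubic forms. -/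

import Mathlib

open scoped LinearAlgebra.Projectivization

/-- Projective 3-space over `k`, as the set of its `k`-rational points, that is, of the
one-dimensional linear subspaces of `k⁴`. -/
abbrev P3 (k : Type*) [Field k] : Type _ := ℙ k (Fin 4 → k)

/-- `X ⊆ ℙ³` is a linear subspace of (projective) dimension `d`: the set of points contained in
a linear subspace of `k⁴` of dimension `d + 1`. -/
def IsLinearSubspace {k : Type*} [Field k] (d : ℕ) (X : Set (P3 k)) : Prop :=
  ∃ U : Submodule k (Fin 4 → k), Module.finrank k U = d + 1 ∧ X = {P | P.submodule ≤ U}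

/-- A line in `ℙ³`. -/
def IsLine {k : Type*} [Field k] (X : Set (P3 k)) : Prop := IsLinearSubspace 1 X

/-- A plane in `ℙ³`. -/
def IsPlane {k : Type*} [Field k] (X : Set (P3 k)) : Prop := IsLinearSubspace 2 X

/-- The polynomial `f` vanishes at the point `P` of `ℙ³`, that is, at every vector of homogeneous
coordinates of `P`. For homogeneous `f` one such vector suffices. -/
def VanishesAt {k : Type*} [Field k] (f : MvPolynomial (Fin 4) k) (P : P3 k) : Prop :=
  ∀ (v : Fin 4 → k) (hv : v ≠ 0), Projectivization.mk k v hv = P → MvPolynomial.eval v f = 0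

/-- A quadric surface in `ℙ³`: the zero locus of a nonzero quadratic form. -/
def IsQuadricSurface {k : Type*} [Field k] (Q : Set (P3 k)) : Prop :=
  ∃ q : MvPolynomial (Fin 4) k, q ≠ 0 ∧ q.IsHomogeneous 2 ∧ Q = {P | VanishesAt q P}

/-- The `k`-vector space of homogeneous forms of degree `d` which vanish on `X ⊆ ℙ³`. For a closed
subset `X` with its reduced structure, over an algebraically closed field, this is
`H⁰(𝓘_X(d))`. -/
noncomputable def formsVanishingOn {k : Type*} [Field k] (X : Set (P3 k)) (d : ℕ) :
    Submodule k (MvPolynomial (Fin 4) k) where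
  carrier := {f | f.IsHomogeneous d ∧ ∀ P ∈ X, VanishesAt f P}
  zero_mem' := ⟨MvPolynomial.isHomogeneous_zero _ _ _, fun _ _ v _ _ => map_zero _⟩
  add_mem' := by
    rintro f g ⟨hf, hf'⟩ ⟨hg, hg'⟩
    refine ⟨hf.add hg, fun P hP v hv h => ?_⟩
    rw [map_add, hf' P hP v hv h, hg' P hP v hv h, add_zero]
  smul_mem' := by
    rintro c f ⟨hf, hf'⟩
    refine ⟨(MvPolynomial.homogeneousSubmodule (Fin 4) k d).smul_mem c hf, fun P hP v hv h => ?_⟩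
    rw [MvPolynomial.smul_eval, hf' P hP v hv h, mul_zero]

/-- The homogeneous ideal of `X ⊆ ℙ³` in `k[x₀, x₁, x₂, x₃]`: the ideal generated by all the
homogeneous polynomials which vanish on `X`. -/
noncomputable def homogeneousIdealOf {k : Type*} [Field k] (X : Set (P3 k)) : Ideal (MvPolynomial (Fin 4) k) :=
  Ideal.span {f | ∃ d : ℕ, f ∈ formsVanishingOn X d}

/-- The ideal `I` is generated by forms of degree `d`. -/
def IsGeneratedByForms {k : Type*} [Field k] (I : Ideal (MvPolynomial (Fin 4) k)) (d : ℕ) : Prop :=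
  ∃ G : Set (MvPolynomial (Fin 4) k), (∀ g ∈ G, g.IsHomogeneous d) ∧ I = Ideal.span G

/-! In suitable coordinates the lines are standard and lie on `q = stdQuadric k`. The ideal of their
union is generated by `q` and the products of three linear forms, one through each line
(`mem_span_of_eval_linePoint`).

Let `J` be the ideal generated by the cubics through the lines and the points, and let `y i` be the
linear coordinates dual to the points. Since `q` is nonzero at each point, subtracting `q` times a
combination of the `y i` from any cubic through the lines puts it in `J`. So a form `G` vanishing on
everything is `q * R` modulo `J`, where `R` vanishes at the points and hence lies in the ideal of
the `y i * y j`, `i ≠ j` (`mem_span_X_mul_X_of_axisSub`).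

It remains to see that `q * y i * y j ∈ J`. The quadrics through two of the lines form a space of
dimension four, so the cohomological hypothesis yields one equal to 1 at `p j` and 0 at the other
points (`exists_quadric_eval_eq`). Multiplying it by the two equations of the third line and
eliminating it gives `q * y j * h ∈ J`, with `h` the plane through that line and `p j`. As `p j` is
off the quadric, the three planes so obtained meet only in `p j`; their equations span all linear
forms vanishing at `p j`, among them `y i` (`mem_span_stdCubics`). -/

open MvPolynomial

/-! ### Linear changes of coordinates. -/

section Substitution

variable {k : Type*} [Field k]

/-- A substitution is congruent to the identity modulo the differences it makes to the variables. -/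
theorem sub_aeval_mem_span {σ : Type*} (g : σ → MvPolynomial σ k) (f : MvPolynomial σ k)
    (I : Ideal (MvPolynomial σ k)) (h : ∀ i, X i - g i ∈ I) : f - aeval g f ∈ I := by
  rw [← Ideal.Quotient.eq]
  have : (Ideal.Quotient.mkₐ k I) = (Ideal.Quotient.mkₐ k I).comp (aeval g) := by
    ext i
    simpa using Ideal.Quotient.eq.2 (h i)
  exact DFunLike.congr_fun this f

/-- Precomposition of polynomial functions on `k⁴` with a linear map. -/
noncomputable def linSub (e : (Fin 4 → k) →ₗ[k] (Fin 4 → k)) :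
    MvPolynomial (Fin 4) k →ₐ[k] MvPolynomial (Fin 4) k :=
  aeval fun i => ∑ j, C (e (Pi.single j 1) i) * X j

theorem eval_linSub (e : (Fin 4 → k) →ₗ[k] (Fin 4 → k)) (v : Fin 4 → k)
    (f : MvPolynomial (Fin 4) k) : eval v (linSub e f) = eval (e v) f := by
  rw [linSub, ← aeval_eq_eval, ← aeval_eq_eval, ← AlgHom.comp_apply]
  congr 1
  ext i
  conv_rhs => rw [aeval_X, LinearMap.pi_apply_eq_sum_univ e v]
  have : ∀ j : Fin 4, (fun i => if j = i then (1 : k) else 0) = Pi.single j 1 := fun j => by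
    ext i; simp [Pi.single_apply, eq_comm]
  simp [this, mul_comm]

theorem isHomogeneous_linSub (e : (Fin 4 → k) →ₗ[k] (Fin 4 → k)) {f : MvPolynomial (Fin 4) k}
    {d : ℕ} (hf : f.IsHomogeneous d) : (linSub e f).IsHomogeneous d := by
  have := hf.aeval (fun i => ∑ j, C (e (Pi.single j 1) i) * X j) (n := 1)
    (fun i => IsHomogeneous.sum _ _ _ fun j _ => (isHomogeneous_X k j).C_mul _)
  simpa [linSub] using this

theorem linSub_linSub_of_inverse [Infinite k] (e e' : (Fin 4 → k) →ₗ[k] (Fin 4 → k))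
    (h : ∀ v, e (e' v) = v) (f : MvPolynomial (Fin 4) k) : linSub e' (linSub e f) = f :=
  MvPolynomial.funext fun v => by rw [eval_linSub, eval_linSub, h]

theorem eval_smul_of_isHomogeneous {f : MvPolynomial (Fin 4) k} {d : ℕ} (hf : f.IsHomogeneous d)
    (t : k) (v : Fin 4 → k) : eval (t • v) f = t ^ d * eval v f := by
  rw [eval_eq, eval_eq, Finset.mul_sum]
  refine Finset.sum_congr rfl fun m hm => ?_
  simp only [Pi.smul_apply, smul_eq_mul, mul_pow, Finset.prod_mul_distrib]
  rw [Finset.prod_pow_eq_pow_sum, ← hf.degree_eq_sum_deg_support hm]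
  rw [mul_left_comm]

end Substitution

/-! ### Ideals of the coordinate points and of three skew lines. -/

section Ideals

variable {k : Type*} [Field k]

/-- The restriction of a polynomial to the `i`-th coordinate axis. -/
noncomputable def axisSub (i : Fin 4) : MvPolynomial (Fin 4) k →ₐ[k] MvPolynomial (Fin 4) k :=
  aeval fun j => if j = i then X i else 0

/-- A polynomial vanishing on the coordinate axes lies in the ideal generated by the products
of two distinct variables. -/
theorem mem_span_X_mul_X_of_axisSub (f : MvPolynomial (Fin 4) k)
    (hf : ∀ i, axisSub i f = 0) :
    f ∈ Ideal.span {g : MvPolynomial (Fin 4) k | ∃ i j, i ≠ j ∧ g = X i * X j} := by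
  set D := Ideal.span {g : MvPolynomial (Fin 4) k | ∃ i j, i ≠ j ∧ g = X i * X j}
  -- Modulo `D` only pure powers survive; the four restrictions count the constant term four times,
  -- hence the 3.
  have key : ∀ g : MvPolynomial (Fin 4) k,
      g - (∑ i, axisSub i g - 3 * C (constantCoeff g)) ∈ D := by
    intro g
    induction g using MvPolynomial.induction_on with
    | C a =>
      convert D.zero_mem using 1
      simp [axisSub]
      ring
    | add p r hp hr =>
      convert D.add_mem hp hr using 1
      simp only [map_add, Finset.sum_add_distrib]
      ring
    | mul_X p j _ =>
      have h1 : ∀ i, axisSub i (p * X j : MvPolynomial (Fin 4) k)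
          = if i = j then axisSub j p * X j else 0 := by
        intro i
        by_cases h : i = j
        · subst h; simp [axisSub]
        · have : j ≠ i := Ne.symm h
          simp [axisSub, h, this]
      simp only [h1, Finset.sum_ite_eq', Finset.mem_univ, if_true, map_mul, constantCoeff_X,
        mul_zero, C_0, sub_zero]
      rw [← sub_mul]
      have h2 : p - axisSub j p ∈ Ideal.span 
          {g : MvPolynomial (Fin 4) k | ∃ i, i ≠ j ∧ g = X i} := by
        refine sub_aeval_mem_span _ _ _ fun i => ?_
        by_cases h : i = j
        · simp [h]
        · rw [if_neg h, sub_zero]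
          exact Ideal.subset_span ⟨i, h, rfl⟩
      generalize p - axisSub j p = x at h2
      induction h2 using Submodule.span_induction with
      | mem x hx =>
        obtain ⟨i, hij, rfl⟩ := hx
        exact Ideal.subset_span ⟨i, j, hij, rfl⟩
      | zero => simp
      | add x y _ _ hx hy => rw [add_mul]; exact D.add_mem hx hy
      | smul a x _ hx => rw [smul_eq_mul, mul_assoc]; exact D.mul_mem_left a hx
  have h0 : constantCoeff f = 0 := by
    have h1 : constantCoeff (axisSub 0 f) = constantCoeff f := by
      have : ((constantCoeff : MvPolynomial (Fin 4) k →+* k).comp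
          (axisSub (k := k) 0 : MvPolynomial (Fin 4) k →+* MvPolynomial (Fin 4) k))
          = constantCoeff := by
        apply MvPolynomial.ringHom_ext
        · intro r; simp [axisSub]
        · intro i
          simp only [axisSub, RingHom.comp_apply, RingHom.coe_coe, aeval_X]
          split_ifs <;> simp
      exact DFunLike.congr_fun this f
    rw [← h1, hf 0, map_zero]
  simpa [hf, h0] using key f

/-- The quadric containing the three standard lines. -/
noncomputable def stdQuadric (k : Type*) [Field k] : MvPolynomial (Fin 4) k :=
  X 0 * X 3 - X 1 * X 2

/-- The coordinates vanishing on the first, resp. second, resp. third standard line. -/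
noncomputable def lineForm (k : Type*) [Field k] : Fin 3 → Fin 2 → MvPolynomial (Fin 4) k :=
  ![![X 0, X 1], ![X 2, X 3], ![X 0 - X 2, X 1 - X 3]]

/-- Points of the standard lines. -/
def linePoint {k : Type*} [Field k] (l : Fin 3) (a b : k) : Fin 4 → k :=
  (![![0, 0, a, b], ![a, b, 0, 0], ![a, b, a, b]] : Fin 3 → Fin 4 → k) l

/-- The ideal of the union of the three standard lines. -/
theorem mem_span_of_eval_linePoint [Infinite k] (G : MvPolynomial (Fin 4) k)
    (hG : ∀ l a b, eval (linePoint l a b) G = 0) :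
    G ∈ Ideal.span ({stdQuadric k} ∪
      {g | ∃ a b c, g = lineForm k 0 a * lineForm k 1 b * lineForm k 2 c}) := by
  set I := Ideal.span ({stdQuadric k} ∪
      {g | ∃ a b c, g = lineForm k 0 a * lineForm k 1 b * lineForm k 2 c})
  have hq : stdQuadric k ∈ I := Ideal.subset_span (Or.inl rfl)
  have hI : ∀ a b c, lineForm k 0 a * lineForm k 1 b * lineForm k 2 c ∈ I :=
    fun a b c => Ideal.subset_span (Or.inr ⟨a, b, c, rfl⟩)
  have sub_zero_of : ∀ (g : Fin 4 → MvPolynomial (Fin 4) k) (l : Fin 3),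
      (∀ x, ∃ a b, (fun i => eval x (g i)) = linePoint l a b) → aeval g G = 0 := by
    intro g l h
    refine MvPolynomial.funext fun x => ?_
    obtain ⟨a, b, hab⟩ := h x
    rw [map_zero, ← hG l a b, ← hab, ← aeval_eq_eval, ← aeval_eq_eval, ← AlgHom.comp_apply]
    congr 1
    ext i
    simp
  -- vanishing on the first line
  have h1 : G ∈ Ideal.span {(X 0 : MvPolynomial (Fin 4) k), X 1} := by
    have := sub_aeval_mem_span (![0, 0, X 2, X 3] : Fin 4 → MvPolynomial (Fin 4) k) G
      (Ideal.span {X 0, X 1}) (by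
        intro i; fin_cases i
        · simpa using Ideal.subset_span (by simp)
        · simpa using Ideal.subset_span (by simp)
        · simp
        · simp)
    rwa [sub_zero_of _ 0 (fun x => ⟨x 2, x 3, by ext i; fin_cases i <;> simp [linePoint]⟩),
      sub_zero] at this
  obtain ⟨A, B, hAB⟩ := Ideal.mem_span_pair.1 h1
  -- vanishing on the second line
  have hv := sub_zero_of ![X 0, X 1, 0, 0] 1
    (fun x => ⟨x 0, x 1, by ext i; fin_cases i <;> simp [linePoint]⟩)
  have hs : ∀ H : MvPolynomial (Fin 4) k, ∃ H2 H3,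
      H2 * X 2 + H3 * X 3 = H - aeval (![X 0, X 1, 0, 0] : Fin 4 → MvPolynomial (Fin 4) k) H := by
    intro H
    rw [← Ideal.mem_span_pair]
    refine sub_aeval_mem_span _ _ _ fun i => ?_
    fin_cases i
    · simp
    · simp
    · simpa using Ideal.subset_span (by simp)
    · simpa using Ideal.subset_span (by simp)
  obtain ⟨A2, A3, hA⟩ := hs A
  obtain ⟨B2, B3, hB⟩ := hs B
  -- vanishing on the third line
  have hw := sub_zero_of ![X 0, X 1, X 0, X 1] 2
    (fun x => ⟨x 0, x 1, by ext i; fin_cases i <;> simp [linePoint]⟩)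
  have ht : ∀ H : MvPolynomial (Fin 4) k, ∃ H2 H3,
      H2 * (X 0 - X 2) + H3 * (X 1 - X 3) = H - aeval (![X 0, X 1, X 0, X 1] : Fin 4 → MvPolynomial (Fin 4) k) H := by
    intro H
    rw [← Ideal.mem_span_pair]
    refine sub_aeval_mem_span _ _ _ fun i => ?_
    fin_cases i
    · simp
    · simp
    · have : (X 2 - X 0 : MvPolynomial (Fin 4) k) = -(X 0 - X 2) := by ring
      simp only [Fin.reduceFinMk, Matrix.cons_val]
      rw [this, neg_mem_iff]
      exact Ideal.subset_span (by simp)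
    · have : (X 3 - X 1 : MvPolynomial (Fin 4) k) = -(X 1 - X 3) := by ring
      simp only [Fin.reduceFinMk, Matrix.cons_val]
      rw [this, neg_mem_iff]
      exact Ideal.subset_span (by simp)
  have hG2 : G = X 0 * (A2 * X 2 + A3 * X 3) + X 1 * (B2 * X 2 + B3 * X 3) := by
    have : X 0 * aeval (![X 0, X 1, 0, 0] : Fin 4 → MvPolynomial (Fin 4) k) A + X 1 * aeval (![X 0, X 1, 0, 0] : Fin 4 → MvPolynomial (Fin 4) k) B = 0 := by
      rw [← hAB] at hv
      simp only [map_add, map_mul, aeval_X, Matrix.cons_val] at hv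
      linear_combination hv
    rw [hA, hB, ← hAB]
    linear_combination this
  obtain ⟨a2, a2', ha2⟩ := ht A2
  obtain ⟨a3, a3', ha3⟩ := ht A3
  obtain ⟨b2, b2', hb2⟩ := ht B2
  obtain ⟨b3, b3', hb3⟩ := ht B3
  rw [hG2] at hw
  simp only [map_add, map_mul, aeval_X, Matrix.cons_val] at hw
  set K00 := aeval (![X 0, X 1, X 0, X 1] : Fin 4 → MvPolynomial (Fin 4) k) A2
  set K01 := aeval (![X 0, X 1, X 0, X 1] : Fin 4 → MvPolynomial (Fin 4) k) A3
  set K10 := aeval (![X 0, X 1, X 0, X 1] : Fin 4 → MvPolynomial (Fin 4) k) B2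
  set K11 := aeval (![X 0, X 1, X 0, X 1] : Fin 4 → MvPolynomial (Fin 4) k) B3
  have nd : ∀ i j : Fin 4, i ≠ j → ¬ (X i : MvPolynomial (Fin 4) k) ∣ X j := by
    intro i j hij h
    rw [X_dvd_X] at h
    exact hij h
  have p0 : Prime (X 0 : MvPolynomial (Fin 4) k) := X_prime
  have p1 : Prime (X 1 : MvPolynomial (Fin 4) k) := X_prime
  -- On the third line `hw` reads `X0² K00 + X0 X1 (K01 + K10) + X1² K11 = 0`, which forces the
  -- divisibilities below.
  have d0 : X 0 ∣ K11 := by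
    have : X 0 ∣ X 1 * (X 1 * K11) :=
      ⟨-(X 0 * K00 + X 1 * K01 + X 1 * K10), by linear_combination hw⟩
    exact (p0.dvd_or_dvd ((p0.dvd_or_dvd this).resolve_left (nd 0 1 (by decide)))).resolve_left
      (nd 0 1 (by decide))
  have d1 : X 1 ∣ K00 := by
    have : X 1 ∣ X 0 * (X 0 * K00) :=
      ⟨-(X 1 * K11 + X 0 * K01 + X 0 * K10), by linear_combination hw⟩
    exact (p1.dvd_or_dvd ((p1.dvd_or_dvd this).resolve_left (nd 1 0 (by decide)))).resolve_left
      (nd 1 0 (by decide))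
  obtain ⟨M, hM⟩ := d0
  obtain ⟨N, hN⟩ := d1
  have hK : X 0 * N + (K01 + K10) + X 1 * M = 0 := by
    have : (X 0 * X 1) * (X 0 * N + (K01 + K10) + X 1 * M) = 0 := by
      rw [hM, hN] at hw
      linear_combination hw
    exact (mul_eq_zero.1 this).resolve_left (mul_ne_zero p0.ne_zero p1.ne_zero)
  -- Replacing each coefficient in `hG2` by its restriction to the third line costs the triple
  -- products; by the syzygy `hK`, what remains is an exact multiple of the quadric.
  have e : G = (-(X 0 * N) - K10) * stdQuadric k
      + a2 * (lineForm k 0 0 * lineForm k 1 0 * lineForm k 2 0)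
      + a2' * (lineForm k 0 0 * lineForm k 1 0 * lineForm k 2 1)
      + a3 * (lineForm k 0 0 * lineForm k 1 1 * lineForm k 2 0)
      + a3' * (lineForm k 0 0 * lineForm k 1 1 * lineForm k 2 1)
      + b2 * (lineForm k 0 1 * lineForm k 1 0 * lineForm k 2 0)
      + b2' * (lineForm k 0 1 * lineForm k 1 0 * lineForm k 2 1)
      + b3 * (lineForm k 0 1 * lineForm k 1 1 * lineForm k 2 0)
      + b3' * (lineForm k 0 1 * lineForm k 1 1 * lineForm k 2 1) := by
    rw [hG2]
    simp only [stdQuadric, lineForm, Matrix.cons_val]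
    linear_combination (-(X 0 * X 2)) * ha2 - X 0 * X 3 * ha3 - X 1 * X 2 * hb2 - X 1 * X 3 * hb3
      + X 0 * X 3 * hK + X 0 * X 2 * hN + X 1 * X 3 * hM
  rw [e]
  repeat' apply I.add_mem
  all_goals first | exact I.mul_mem_left _ hq | exact I.mul_mem_left _ (hI _ _ _)

end Ideals

/-! ### Cubics through the standard lines and four points. -/

section StandardLines

variable {k : Type*} [Field k]

theorem isHomogeneous_lineForm (l : Fin 3) (a : Fin 2) : (lineForm k l a).IsHomogeneous 1 := by
  fin_cases l <;> fin_cases a <;>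
    first
    | exact isHomogeneous_X k _
    | exact (isHomogeneous_X k _).sub (isHomogeneous_X k _)

theorem isHomogeneous_stdQuadric : (stdQuadric k).IsHomogeneous 2 :=
  ((isHomogeneous_X k _).mul (isHomogeneous_X k _)).sub
    ((isHomogeneous_X k _).mul (isHomogeneous_X k _))

theorem eval_linePoint_lineForm (l : Fin 3) (i : Fin 2) (a b : k) :
    eval (linePoint l a b) (lineForm k l i) = 0 := by
  fin_cases l <;> fin_cases i <;> simp [lineForm, linePoint]

theorem eval_linePoint_stdQuadric (l : Fin 3) (a b : k) :
    eval (linePoint l a b) (stdQuadric k) = 0 := by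
  fin_cases l <;> simp [stdQuadric, linePoint, mul_comm]

/-- A quadratic form vanishing on the three standard lines vanishes on `stdQuadric`. -/
theorem eval_eq_zero_of_eval_stdQuadric_eq_zero [Infinite k] {f : MvPolynomial (Fin 4) k}
    (hf : f.IsHomogeneous 2) (hl : ∀ l a b, eval (linePoint l a b) f = 0) {v : Fin 4 → k}
    (hv : eval v (stdQuadric k) = 0) : eval v f = 0 := by
  -- Restriction to the multiples of `v`: a form of degree `d` becomes its value at `v` times `X ^
  -- d`. As the quadric restricts to 0, the ideal of the lines lands in `(X ^ 3)`, which leaves no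
  -- room for degree 2.
  let r : MvPolynomial (Fin 4) k →ₐ[k] Polynomial k := 
    aeval fun i => Polynomial.C (v i) * Polynomial.X
  have hr : ∀ {g : MvPolynomial (Fin 4) k} {d : ℕ}, g.IsHomogeneous d →
      r g = Polynomial.C (eval v g) * Polynomial.X ^ d := by
    intro g d hg
    refine Polynomial.funext fun t => ?_
    have h1 : Polynomial.eval t (r g) = eval (t • v) g := by
      rw [← Polynomial.coe_aeval_eq_eval, ← aeval_eq_eval]
      change ((Polynomial.aeval t).comp r) g = _
      congr 1
      ext i
      simp only [r, AlgHom.comp_apply, aeval_X, map_mul, Polynomial.aeval_C, Polynomial.aeval_X,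
        Algebra.algebraMap_self, RingHom.id_apply, Pi.smul_apply, smul_eq_mul, mul_comm]
    rw [h1, eval_smul_of_isHomogeneous hg]
    rw [Polynomial.eval_mul, Polynomial.eval_C, Polynomial.eval_pow, Polynomial.eval_X, mul_comm]
  have hI := Ideal.mem_map_of_mem r (mem_span_of_eval_linePoint f hl)
  have h3 : Ideal.map r (Ideal.span ({stdQuadric k} ∪
      {g | ∃ a b c, g = lineForm k 0 a * lineForm k 1 b * lineForm k 2 c}))
      ≤ Ideal.span {Polynomial.X ^ 3} := by
    rw [Ideal.map_le_iff_le_comap, Ideal.span_le]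
    rintro g (rfl | ⟨a, b, c, rfl⟩)
    · simp [hr isHomogeneous_stdQuadric, hv]
    · rw [SetLike.mem_coe, Ideal.mem_comap, hr (((isHomogeneous_lineForm 0 a).mul
        (isHomogeneous_lineForm 1 b)).mul (isHomogeneous_lineForm 2 c))]
      exact Ideal.mul_mem_left _ _ (Ideal.subset_span rfl)
  have h4 := Ideal.mem_span_singleton.1 (h3 hI)
  rw [hr hf, Polynomial.X_pow_dvd_iff] at h4
  simpa using h4 2 (by norm_num)

/-- The cubic forms vanishing on the three standard lines and at the points `p i`. -/
def stdCubics (p : Fin 4 → Fin 4 → k) : Set (MvPolynomial (Fin 4) k) :=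
  {f | f.IsHomogeneous 3 ∧ (∀ l a b, eval (linePoint l a b) f = 0) ∧ ∀ i, eval (p i) f = 0}

/-- The heart of the argument, in standard coordinates: reduce `G` to a multiple of the quadric
modulo the cubics, then absorb that multiple. `G` need not be homogeneous, so its vanishing is
required at all multiples of the points. -/
theorem mem_span_stdCubics [Infinite k] (e : (Fin 4 → k) ≃ₗ[k] (Fin 4 → k))
    (p : Fin 4 → Fin 4 → k) (hp : ∀ i, p i = e (Pi.single i 1))
    (hq : ∀ i, eval (p i) (stdQuadric k) ≠ 0)
    (hQ : ∀ (l : Fin 3) (j : Fin 4), ∃ f : MvPolynomial (Fin 4) k, f.IsHomogeneous 2 ∧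
      (∀ m, m ≠ l → ∀ a b, eval (linePoint m a b) f = 0) ∧
      ∀ i, eval (p i) f = if i = j then 1 else 0)
    (G : MvPolynomial (Fin 4) k) (hl : ∀ l a b, eval (linePoint l a b) G = 0)
    (hG : ∀ (t : k) i, eval (t • p i) G = 0) : G ∈ Ideal.span (stdCubics p) := by
  set J := Ideal.span (stdCubics p)
  set q := stdQuadric k with hqdef
  set s : Fin 4 → k := fun i => eval (p i) q
  let y : Fin 4 → MvPolynomial (Fin 4) k := fun i => linSub e.symm.toLinearMap (X i)
  have hy1 : ∀ i, (y i).IsHomogeneous 1 := fun i => isHomogeneous_linSub _ (isHomogeneous_X k i)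
  have hyp : ∀ i j, eval (p j) (y i) = if i = j then 1 else 0 := by
    intro i j
    rw [eval_linSub, hp]
    simp [Pi.single_apply]
  have red : ∀ f : MvPolynomial (Fin 4) k, f.IsHomogeneous 3 →
      (∀ l a b, eval (linePoint l a b) f = 0) →
      f - q * ∑ i, C (eval (p i) f / s i) * y i ∈ J := by
    intro f hf hfl
    refine Ideal.subset_span ⟨?_, fun l a b => ?_, fun i => ?_⟩
    · exact hf.sub (isHomogeneous_stdQuadric.mul
        (IsHomogeneous.sum _ _ _ fun i _ => (hy1 i).C_mul _))
    · simp [hfl, hqdef, eval_linePoint_stdQuadric]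
    · have : eval (p i) q * (eval (p i) f / s i) = eval (p i) f := mul_div_cancel₀ _ (hq i)
      simp [hyp, this]
  -- The last factor is the plane through line `l` and `p j`; it arises by eliminating `f` between
  -- the reductions of its products with the two equations of the line.
  have key : ∀ (l : Fin 3) (j : Fin 4),
      q * y j * (lineForm k l 0 * C (eval (p j) (lineForm k l 1))
        - lineForm k l 1 * C (eval (p j) (lineForm k l 0))) ∈ J := by
    intro l j
    obtain ⟨f, hf, hfl, hfp⟩ := hQ l j
    have h : ∀ a, lineForm k l a * f - q * (C (eval (p j) (lineForm k l a) / s j) * y j) ∈ J := by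
      intro a
      convert red (lineForm k l a * f) ((isHomogeneous_lineForm l a).mul hf) ?_ using 3
      · simp only [map_mul, hfp]
        rw [Finset.sum_eq_single j]
        · simp
        · intro i _ hij; simp [hij]
        · simp
      · intro m a' b
        by_cases hm : m = l
        · subst hm; simp [eval_linePoint_lineForm]
        · simp [hfl m hm]
    have h2 : ∀ a, C (eval (p j) (lineForm k l a)) =
        (C (s j) * C (eval (p j) (lineForm k l a) / s j) : MvPolynomial (Fin 4) k) := by
      intro a
      rw [← C_mul, mul_div_cancel₀ _ (hq j)]
    convert J.mul_mem_left (C (s j)) (J.sub_mem (J.mul_mem_left (lineForm k l 1) (h 0))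
      (J.mul_mem_left (lineForm k l 0) (h 1))) using 1
    rw [h2 0, h2 1]
    ring
  have hyy : ∀ i j, i ≠ j → q * (y i * y j) ∈ J := by
    intro i j hij
    obtain ⟨m, hm⟩ : ∃ m : Fin 4 → k, y i = ∑ t, C (m t) * X t :=
      ⟨fun t => e.symm (Pi.single t 1) i, by simp [y, linSub]⟩
    have h0 := hyp i j
    rw [if_neg hij, hm] at h0
    simp only [Fin.sum_univ_four, map_add, map_mul, eval_C, eval_X] at h0
    have h0' := congrArg (C : k → MvPolynomial (Fin 4) k) h0
    simp only [map_add, map_mul, map_zero] at h0'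
    have hs : s j = p j 0 * p j 3 - p j 1 * p j 2 := by simp [s, hqdef, stdQuadric]
    have k0 := key 0 j
    have k1 := key 1 j
    have k2 := key 2 j
    simp only [lineForm, Matrix.cons_val, eval_X, map_sub] at k0 k1 k2
    -- Cramer's rule: `s j * y i` is an explicit combination of the three planes, up to a multiple
    -- of `y i` evaluated at `p j`, which is zero by `h0'`.
    have hmem : C (s j) * (q * (y i * y j)) ∈ J := by
      convert J.add_mem (J.sub_mem (J.mul_mem_left (C (m 0 * p j 0 + m 1 * p j 1))
          (J.sub_mem (J.add_mem k0 k1) k2))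
          (J.mul_mem_left (C (m 0 * p j 2 + m 1 * p j 3)) k0))
          (J.mul_mem_left (C (m 2 * p j 0 + m 3 * p j 1)) k1) using 1
      rw [hm, hs, Fin.sum_univ_four]
      simp only [map_add, map_mul, map_sub]
      linear_combination (-(q * y j) * (X 2 * C (p j 1) - X 3 * C (p j 0))) * h0'
    have := J.mul_mem_left (C (s j)⁻¹) hmem
    rwa [← mul_assoc, ← C_mul, inv_mul_cancel₀ (hq j), C_1, one_mul] at this
  have hN : ∃ R, G - q * R ∈ J := by
    have := mem_span_of_eval_linePoint G hl
    clear hl hG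
    induction this using Submodule.span_induction with
    | mem x hx =>
      rcases hx with rfl | ⟨a, b, c, rfl⟩
      · exact ⟨1, by simp [hqdef]⟩
      · refine ⟨_, red _ (((isHomogeneous_lineForm 0 a).mul (isHomogeneous_lineForm 1 b)).mul
          (isHomogeneous_lineForm 2 c)) fun l a b => ?_⟩
        fin_cases l <;> simp [eval_linePoint_lineForm]
    | zero => exact ⟨0, by simp⟩
    | add x y _ _ hx hy =>
      obtain ⟨R, hR⟩ := hx
      obtain ⟨R', hR'⟩ := hy
      exact ⟨R + R', by convert J.add_mem hR hR' using 1; ring⟩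
    | smul a x _ hx =>
      obtain ⟨R, hR⟩ := hx
      exact ⟨a * R, by convert J.mul_mem_left a hR using 1; rw [smul_eq_mul]; ring⟩
  obtain ⟨R, hR⟩ := hN
  have hJ : ∀ f ∈ J, ∀ (t : k) i, eval (t • p i) f = 0 := by
    intro f hf t i
    have : J ≤ RingHom.ker (eval (t • p i)) := by
      refine Ideal.span_le.2 fun g hg => ?_
      rw [SetLike.mem_coe, RingHom.mem_ker, eval_smul_of_isHomogeneous hg.1, hg.2.2 i, mul_zero]
    exact this hf
  have heval : ∀ (f : MvPolynomial (Fin 4) k) (x : Fin 4 → k) i,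
      eval x (axisSub i (linSub e.toLinearMap f)) = eval (x i • p i) f := by
    intro f x i
    have : ∀ g, eval x (axisSub i g) = eval (x i • Pi.single i 1) g := by
      intro g
      rw [← aeval_eq_eval, ← aeval_eq_eval, ← AlgHom.comp_apply]
      congr 1
      ext j
      by_cases h : j = i
      · subst h; simp [axisSub]
      · simp [axisSub, h]
    rw [this, eval_linSub, hp]
    simp
  -- Along the axis through `p i` the product `q * R` vanishes but `q` does not, and polynomials
  -- form a domain.
  have hR0 : ∀ i, axisSub i (linSub e.toLinearMap R) = 0 := by
    intro i
    have h1 : axisSub i (linSub e.toLinearMap (q * R)) = 0 := by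
      refine MvPolynomial.funext fun x => ?_
      have := hJ _ hR (x i) i
      rw [map_sub, hG, zero_sub, neg_eq_zero] at this
      rw [heval, this, map_zero]
    have h2 : axisSub i (linSub e.toLinearMap q) ≠ 0 := by
      intro h
      apply hq i
      have := heval q 1 i
      rw [h] at this
      simpa using this.symm
    rw [map_mul, map_mul] at h1
    exact (mul_eq_zero.1 h1).resolve_left h2
  have hR1 := mem_span_X_mul_X_of_axisSub _ hR0
  have hR2 : q * linSub e.symm.toLinearMap (linSub e.toLinearMap R) ∈ J := by
    generalize linSub e.toLinearMap R = x at hR1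
    induction hR1 using Submodule.span_induction with
    | mem x hx =>
      obtain ⟨i, j, hij, rfl⟩ := hx
      rw [map_mul]
      exact hyy i j hij
    | zero => simp
    | add x y _ _ hx hy => rw [map_add, mul_add]; exact J.add_mem hx hy
    | smul a x _ hx =>
      rw [smul_eq_mul, map_mul, mul_left_comm]
      exact J.mul_mem_left _ hx
  rw [linSub_linSub_of_inverse _ _ (by simp)] at hR2
  simpa using J.add_mem hR hR2

end StandardLines

/-! ### Normal form of three skew lines, and quadrics through two of them. -/

section Coordinates

variable {k : Type*} [Field k]

theorem linePoint_eq (l : Fin 3) (a b : k) :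
    linePoint l a b = a • linePoint l 1 0 + b • linePoint l 0 1 := by
  fin_cases l <;> ext i <;> fin_cases i <;> simp [linePoint]

theorem linePoint_eq_zero {l : Fin 3} {a b : k} (h : linePoint l a b = 0) : a = 0 ∧ b = 0 := by
  fin_cases l
  · exact ⟨congrFun h 2, congrFun h 3⟩
  · exact ⟨congrFun h 0, congrFun h 1⟩
  · exact ⟨congrFun h 0, congrFun h 1⟩

/-- Three mutually disjoint lines are the standard lines in suitable coordinates. -/
theorem exists_equiv_mem_iff_linePoint (U : Fin 3 → Submodule k (Fin 4 → k))
    (hU : ∀ l, Module.finrank k (U l) = 2) (hdisj : ∀ l m, l ≠ m → U l ⊓ U m = ⊥) :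
    ∃ E : (Fin 4 → k) ≃ₗ[k] (Fin 4 → k),
      ∀ l v, v ∈ U l ↔ ∃ a b, v = E (linePoint l a b) := by
  have hzero : ∀ {l m v}, l ≠ m → v ∈ U l → v ∈ U m → v = 0 := by
    intro l m v hlm hl hm
    have : v ∈ U l ⊓ U m := ⟨hl, hm⟩
    rwa [hdisj l m hlm, Submodule.mem_bot] at this
  have htop : U 0 ⊔ U 1 = ⊤ := by
    apply Submodule.eq_top_of_finrank_eq
    have := Submodule.finrank_sup_add_finrank_inf_eq (U 0) (U 1)
    rw [hdisj 0 1 (by decide), finrank_bot, hU, hU] at this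
    simpa using this
  have hdec : ∀ v, ∃ x ∈ U 0, ∃ y ∈ U 1, x + y = v := fun v =>
    Submodule.mem_sup.1 (htop ▸ Submodule.mem_top)
  let b := Module.finBasisOfFinrankEq k (U 2) (hU 2)
  obtain ⟨x0, hx0, y0, hy0, h0⟩ := hdec (b 0)
  obtain ⟨x1, hx1, y1, hy1, h1⟩ := hdec (b 1)
  have hb : ∀ s t : k, s • (b 0 : Fin 4 → k) + t • (b 1 : Fin 4 → k) = 0 → s = 0 ∧ t = 0 := by
    intro s t h
    have hli : LinearIndependent k ![b 0, b 1] := by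
      have := b.linearIndependent
      rwa [show (b : Fin 2 → U 2) = ![b 0, b 1] by ext i; fin_cases i <;> rfl] at this
    exact LinearIndependent.pair_iff.1 hli s t (Subtype.ext (by simpa using h))
  have hbm : ∀ s t : k, s • (b 0 : Fin 4 → k) + t • (b 1 : Fin 4 → k) ∈ U 2 := fun s t =>
    (U 2).add_mem ((U 2).smul_mem _ (b 0).2) ((U 2).smul_mem _ (b 1).2)
  have hxm : ∀ s t : k, s • x0 + t • x1 ∈ U 0 := fun s t =>
    (U 0).add_mem ((U 0).smul_mem _ hx0) ((U 0).smul_mem _ hx1)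
  have hym : ∀ s t : k, s • y0 + t • y1 ∈ U 1 := fun s t =>
    (U 1).add_mem ((U 1).smul_mem _ hy0) ((U 1).smul_mem _ hy1)
  have hxy : ∀ s t : k, s • (b 0 : Fin 4 → k) + t • (b 1 : Fin 4 → k)
      = (s • x0 + t • x1) + (s • y0 + t • y1) := by
    intro s t; rw [← h0, ← h1]; module
  have hx : ∀ s t : k, s • x0 + t • x1 = 0 → s = 0 ∧ t = 0 := by
    intro s t h
    refine hb s t (hzero (show (1 : Fin 3) ≠ 2 by decide) ?_ (hbm s t))
    rw [hxy, h, zero_add]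
    exact hym s t
  have hy : ∀ s t : k, s • y0 + t • y1 = 0 → s = 0 ∧ t = 0 := by
    intro s t h
    refine hb s t (hzero (show (0 : Fin 3) ≠ 2 by decide) ?_ (hbm s t))
    rw [hxy, h, add_zero]
    exact hxm s t
  -- A basis of `U 2` is split along `U 0 ⊕ U 1`; its components are bases of the summands. The `y`s
  -- come first because the first standard line has its first two coordinates zero.
  let F : (Fin 4 → k) →ₗ[k] (Fin 4 → k) := Fintype.linearCombination k ![y0, y1, x0, x1]
  have hF : ∀ v, F v = (v 2 • x0 + v 3 • x1) + (v 0 • y0 + v 1 • y1) := by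
    intro v
    simp only [F, Fintype.linearCombination_apply, Fin.sum_univ_four, Matrix.cons_val]
    module
  have hinj : Function.Injective F := by
    rw [← LinearMap.ker_eq_bot, LinearMap.ker_eq_bot']
    intro v hv
    rw [hF] at hv
    have e1 : v 2 • x0 + v 3 • x1 = 0 := by
      refine hzero (show (0 : Fin 3) ≠ 1 by decide) (hxm _ _) ?_
      rw [eq_neg_of_add_eq_zero_left hv]
      exact (U 1).neg_mem (hym _ _)
    rw [e1, zero_add] at hv
    obtain ⟨e2, e3⟩ := hx _ _ e1
    obtain ⟨e4, e5⟩ := hy _ _ hv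
    ext i; fin_cases i <;> assumption
  let E := LinearEquiv.ofInjectiveEndo F hinj
  have hE : ∀ v, E v = F v := fun v => rfl
  refine ⟨E, fun l v => ?_⟩
  have hmem : ∀ a b, E (linePoint l a b) ∈ U l := by
    intro a b
    rw [hE, hF]
    fin_cases l
    · simpa [linePoint] using hxm a b
    · simpa [linePoint] using hym a b
    · simpa [linePoint, ← hxy] using hbm a b
  have hspan : Submodule.span k {E (linePoint l 1 0), E (linePoint l 0 1)} = U l := by
    apply Submodule.eq_of_le_of_finrank_eq
    · rw [Submodule.span_le]
      rintro _ (rfl | rfl)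
      · exact hmem _ _
      · exact hmem _ _
    · have hli : LinearIndependent k ![E (linePoint l 1 0), E (linePoint l 0 1)] := by
        rw [LinearIndependent.pair_iff]
        intro s t h
        rw [← map_smul, ← map_smul, ← map_add, ← linePoint_eq, E.map_eq_zero_iff] at h
        exact linePoint_eq_zero h
      have := finrank_span_eq_card hli
      rw [Matrix.range_cons_cons_empty] at this
      rw [this, hU, Fintype.card_fin]
  rw [← hspan, Submodule.mem_span_pair]
  refine exists_congr fun a => exists_congr fun b => ?_
  rw [← map_smul, ← map_smul, ← map_add, ← linePoint_eq, eq_comm]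

/-- If no quadratic form vanishes on two of the standard lines and at the four points `p i`, then
the quadratic forms vanishing on the two lines take arbitrary values at the points. -/
theorem exists_quadric_eval_eq (p : Fin 4 → Fin 4 → k) (l : Fin 3)
    (h : ∀ f : MvPolynomial (Fin 4) k, f.IsHomogeneous 2 →
      (∀ m, m ≠ l → ∀ a b, eval (linePoint m a b) f = 0) → (∀ i, eval (p i) f = 0) → f = 0)
    (c : Fin 4 → k) :
    ∃ f : MvPolynomial (Fin 4) k, f.IsHomogeneous 2 ∧
      (∀ m, m ≠ l → ∀ a b, eval (linePoint m a b) f = 0) ∧ ∀ i, eval (p i) f = c i := by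
  let T : (Fin 2 × Fin 2 → k) →ₗ[k] MvPolynomial (Fin 4) k :=
    Fintype.linearCombination k fun x => lineForm k (l + 1) x.1 * lineForm k (l + 2) x.2
  have hT : ∀ c, T c = ∑ x, c x • (lineForm k (l + 1) x.1 * lineForm k (l + 2) x.2) :=
    fun c => Fintype.linearCombination_apply ..
  have hT1 : ∀ c, (T c).IsHomogeneous 2 := by
    intro c
    rw [hT]
    refine IsHomogeneous.sum _ _ _ fun x _ => ?_
    rw [smul_eq_C_mul]
    exact ((isHomogeneous_lineForm _ _).mul (isHomogeneous_lineForm _ _)).C_mul _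
  have hT2 : ∀ c m, m ≠ l → ∀ a b, eval (linePoint m a b) (T c) = 0 := by
    intro c m hm a b
    have : m = l + 1 ∨ m = l + 2 := by
      clear * - hm; decide +revert
    rw [hT, map_sum]
    refine Finset.sum_eq_zero fun x _ => ?_
    rcases this with rfl | rfl <;> simp [eval_linePoint_lineForm]
  have hT3 : ∀ c, T c = 0 → c = 0 := by
    intro c hc
    -- At a sum of points of the two lines, each linear factor sees only the point of the other
    -- line, so basis points isolate the coefficients up to sign.
    have key : ∀ a b a' b', eval (linePoint (l + 1) a b + linePoint (l + 2) a' b') (T c) = 0 := by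
      simp [hc]
    have k00 := key 1 0 1 0
    have k01 := key 1 0 0 1
    have k10 := key 0 1 1 0
    have k11 := key 0 1 0 1
    simp only [hT, Fintype.sum_prod_type, Fin.sum_univ_two] at k00 k01 k10 k11
    funext ⟨a, b⟩
    fin_cases l <;> simp [lineForm, linePoint] at k00 k01 k10 k11 <;> fin_cases a <;>
      fin_cases b <;> assumption
  let ev : (Fin 2 × Fin 2 → k) →ₗ[k] (Fin 4 → k) :=
    LinearMap.pi fun i => (aeval (p i)).toLinearMap ∘ₗ T
  have hev : ∀ c i, ev c i = eval (p i) (T c) := fun c i => by simp [ev, aeval_eq_eval]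
  have hinj : Function.Injective ev := by
    rw [← LinearMap.ker_eq_bot, LinearMap.ker_eq_bot']
    intro c hc
    exact hT3 c (h _ (hT1 c) (hT2 c) fun i => by rw [← hev, hc]; rfl)
  -- Four products of linear forms against four points: injectivity gives surjectivity.
  have hsurj := (LinearMap.injective_iff_surjective_of_finrank_eq_finrank (by simp)).1 hinj
  obtain ⟨d, hd⟩ := hsurj c
  exact ⟨T d, hT1 d, hT2 d, fun i => by rw [← hev, hd]⟩

end Coordinates

/-! ### Passage between projective space and vectors. -/

section Projective

variable {k : Type*} [Field k]

/-- If the representatives did not span, a nonzero functional would kill them, and its kernel would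
be a plane containing the points. -/
theorem linearIndependent_rep_of_not_subset_plane (P : Fin 4 → P3 k)
    (hplane : ∀ H : Set (P3 k), IsPlane H → ¬ Set.range P ⊆ H) :
    LinearIndependent k fun i => (P i).rep := by
  apply linearIndependent_of_top_le_span_of_card_eq_finrank _ (by simp)
  by_contra hlt
  obtain ⟨f, hf, hle⟩ := Submodule.exists_le_ker_of_lt_top _ (lt_top_iff_ne_top.2
    fun h => hlt h.ge)
  refine hplane _ ⟨LinearMap.ker f, ?_, rfl⟩ ?_
  · have := Module.Dual.finrank_ker_add_one_of_ne_zero hf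
    simp at this
    omega
  · rintro _ ⟨i, rfl⟩
    rw [Set.mem_ofPred_eq, Projectivization.submodule_eq, Submodule.span_singleton_le_iff_mem]
    exact hle (Submodule.subset_span ⟨i, rfl⟩)

theorem eval_smul_rep_eq_zero {f : MvPolynomial (Fin 4) k} {d : ℕ} (hf : f.IsHomogeneous d)
    {P : P3 k} (h : VanishesAt f P) (t : k) : eval (t • P.rep) f = 0 := by
  rw [eval_smul_of_isHomogeneous hf, h _ P.rep_nonzero P.mk_rep, mul_zero]

theorem vanishesAt_of_eval_rep {f : MvPolynomial (Fin 4) k} {d : ℕ} (hf : f.IsHomogeneous d)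
    {P : P3 k} (h : eval P.rep f = 0) : VanishesAt f P := by
  rintro v hv rfl
  obtain ⟨a, ha⟩ := Projectivization.exists_smul_eq_mk_rep k v hv
  rw [← ha, Units.smul_def, eval_smul_of_isHomogeneous hf] at h
  exact (mul_eq_zero.1 h).resolve_left (pow_ne_zero _ a.ne_zero)

theorem rep_mem_iff (P : P3 k) (U : Submodule k (Fin 4 → k)) : P.rep ∈ U ↔ P.submodule ≤ U := by
  rw [Projectivization.submodule_eq, Submodule.span_singleton_le_iff_mem]

/-- A form vanishes on a nonempty linear subspace of `ℙ³` if and only if it vanishes on the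
corresponding subspace of `k⁴`. -/
theorem forall_vanishesAt_iff {f : MvPolynomial (Fin 4) k} {d : ℕ} (hf : f.IsHomogeneous d)
    {U : Submodule k (Fin 4 → k)} (hU : U ≠ ⊥) :
    (∀ P : P3 k, P.submodule ≤ U → VanishesAt f P) ↔ ∀ v ∈ U, eval v f = 0 := by
  refine ⟨fun h v hv => ?_, fun h P hP => vanishesAt_of_eval_rep hf (h _ ((rep_mem_iff P U).2 hP))⟩
  have hne : ∀ w ∈ U, w ≠ 0 → eval w f = 0 := by
    intro w hw h0
    refine h (Projectivization.mk k w h0) ?_ w h0 rfl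
    rwa [Projectivization.submodule_mk, Submodule.span_singleton_le_iff_mem]
  by_cases h0 : v = 0
  · obtain ⟨w, hw, hw0⟩ := Submodule.exists_mem_ne_zero_of_ne_bot hU
    rw [h0, ← zero_smul k w, eval_smul_of_isHomogeneous hf, hne w hw hw0, mul_zero]
  · exact hne v hv h0

theorem inf_eq_bot_of_disjoint {U V : Submodule k (Fin 4 → k)}
    (h : Disjoint {P : P3 k | P.submodule ≤ U} {P : P3 k | P.submodule ≤ V}) : U ⊓ V = ⊥ := by
  by_contra hne
  obtain ⟨w, hw, hw0⟩ := Submodule.exists_mem_ne_zero_of_ne_bot hne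
  refine Set.disjoint_left.1 h (show Projectivization.mk k w hw0 ∈ _ from ?_) ?_
  · simpa [Projectivization.submodule_mk] using hw.1
  · simpa [Projectivization.submodule_mk] using hw.2

end Projective

/-! ### The theorem, by transport to standard coordinates and back. -/

theorem lemmaB1 {k : Type*} [Field k] [IsAlgClosed k] [CharZero k]
    (L : Fin 3 → Set (P3 k)) (hL : ∀ l, IsLine (L l))
    (hdisj : ∀ l m, l ≠ m → Disjoint (L l) (L m))
    (Y : Set (P3 k)) (hY : Y = ⋃ l, L l)
    (P : Fin 4 → P3 k) (W : Set (P3 k)) (hW : W = Set.range P)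
    (hplane : ∀ H : Set (P3 k), IsPlane H → ¬ W ⊆ H)
    (Q : Set (P3 k)) (hQ : IsQuadricSurface Q) (hYQ : Y ⊆ Q) (hPQ : ∀ i, P i ∉ Q)
    (hquad : ∀ l, formsVanishingOn ((Y \ L l) ∪ W) 2 = ⊥) :
    IsGeneratedByForms (homogeneousIdealOf (Y ∪ W)) 3 := by
  have : Infinite k := inferInstance
  choose U hU hLU using hL
  obtain rfl : L = fun l => {P | P.submodule ≤ U l} := funext hLU
  subst hY hW
  have hUb : ∀ l, U l ≠ ⊥ := by
    intro l h
    have := hU l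
    rw [h, finrank_bot] at this
    omega
  obtain ⟨E, hE⟩ := exists_equiv_mem_iff_linePoint U hU
    fun l m hlm => inf_eq_bot_of_disjoint (hdisj l m hlm)
  have hline : ∀ {f : MvPolynomial (Fin 4) k} {d : ℕ}, f.IsHomogeneous d → ∀ l,
      (∀ P : P3 k, P.submodule ≤ U l → VanishesAt f P) ↔
        ∀ a b, eval (linePoint l a b) (linSub E.toLinearMap f) = 0 := by
    intro f d hf l
    rw [forall_vanishesAt_iff hf (hUb l)]
    simp only [eval_linSub, hE]
    exact ⟨fun h a b => h _ ⟨a, b, rfl⟩, by rintro h _ ⟨a, b, rfl⟩; exact h a b⟩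
  let p : Fin 4 → Fin 4 → k := fun i => E.symm (P i).rep
  have hp : ∀ i f, eval (p i) (linSub E.toLinearMap f) = eval (P i).rep f := by
    intro i f
    simp [eval_linSub, p]
  have hinv : ∀ f, linSub E.toLinearMap (linSub E.symm.toLinearMap f) = f :=
    linSub_linSub_of_inverse _ _ (by simp)
  have hinv' : ∀ f, linSub E.symm.toLinearMap (linSub E.toLinearMap f) = f :=
    linSub_linSub_of_inverse _ _ (by simp)
  let B := basisOfLinearIndependentOfCardEqFinrank
    (linearIndependent_rep_of_not_subset_plane P hplane) (by simp)
  have hpB : ∀ i, p i = (B.equivFun.symm.trans E.symm) (Pi.single i 1) := by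
    intro i
    simp [p, B]
  -- Any quadric through the lines vanishes wherever the standard one does, so a point off `Q` is
  -- off the standard quadric.
  have hq : ∀ i, eval (p i) (stdQuadric k) ≠ 0 := by
    intro i hi
    obtain ⟨q, -, hq, rfl⟩ := hQ
    refine hPQ i (vanishesAt_of_eval_rep hq ?_)
    rw [← hp]
    refine eval_eq_zero_of_eval_stdQuadric_eq_zero (isHomogeneous_linSub _ hq) (fun l => ?_) hi
    exact (hline hq l).1 fun R hR => hYQ (Set.mem_iUnion.2 ⟨l, hR⟩)
  have hquad' : ∀ l (j : Fin 4), ∃ f : MvPolynomial (Fin 4) k, f.IsHomogeneous 2 ∧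
      (∀ m, m ≠ l → ∀ a b, eval (linePoint m a b) f = 0) ∧
      ∀ i, eval (p i) f = if i = j then 1 else 0 := by
    intro l j
    refine exists_quadric_eval_eq p l (fun f hf hfl hfp => ?_) _
    have hg := isHomogeneous_linSub E.symm.toLinearMap hf
    have hmem : linSub E.symm.toLinearMap f ∈ formsVanishingOn
        (((⋃ l, {P : P3 k | P.submodule ≤ U l}) \ {P : P3 k | P.submodule ≤ U l})
          ∪ Set.range P) 2 := by
      refine ⟨hg, ?_⟩
      rintro R (⟨hR, hRl⟩ | ⟨i, rfl⟩)
      · obtain ⟨m, hm⟩ := Set.mem_iUnion.1 hR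
        refine (hline hg m).2 ?_ R hm
        rw [hinv]
        refine hfl m ?_
        rintro rfl
        exact hRl hm
      · apply vanishesAt_of_eval_rep hg
        rw [← hp, hinv, hfp]
    rw [hquad l, Submodule.mem_bot] at hmem
    rw [← hinv f, hmem, map_zero]
  refine ⟨formsVanishingOn ((⋃ l, {P : P3 k | P.submodule ≤ U l}) ∪ Set.range P) 3,
    fun g hg => hg.1, le_antisymm ?_ (Ideal.span_mono fun g hg => ⟨3, hg⟩)⟩
  refine Ideal.span_le.2 ?_
  rintro G ⟨d, hGd, hG⟩
  have hmem := mem_span_stdCubics _ p hpB hq hquad' (linSub E.toLinearMap G)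
    (fun l => (hline hGd l).1 fun R hR => hG R (Or.inl (Set.mem_iUnion.2 ⟨l, hR⟩)))
    (fun t i => by
      have := eval_smul_rep_eq_zero hGd (hG (P i) (Or.inr ⟨i, rfl⟩)) t
      simpa [eval_linSub, p] using this)
  have hmap := Ideal.mem_map_of_mem (linSub E.symm.toLinearMap) hmem
  rw [hinv', Ideal.map_span] at hmap
  refine Ideal.span_mono ?_ hmap
  rintro _ ⟨f, ⟨hf, hfl, hfp⟩, rfl⟩
  have hg := isHomogeneous_linSub E.symm.toLinearMap hf
  refine ⟨hg, ?_⟩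
  rintro R (hR | ⟨i, rfl⟩)
  · obtain ⟨m, hm⟩ := Set.mem_iUnion.1 hR
    refine (hline hg m).2 ?_ R hm
    rw [hinv]
    exact hfl m
  · apply vanishesAt_of_eval_rep hg
    rw [← hp, hinv, hfp]
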